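/- Let $N,N_c,n,d,r,l_1,l_2$ be integers with $N\ge1$, let $s,\mu_0$ be real and $\beta>1$, and let $B(s)$ denote the closed $\ell_2$-ball of radius $s$ in a complex coordinate space. All indices of vectors in $\mathbb C^N$ are modulo $N$; $\|\cdot\|_F$ is the Frobenius norm. For $x\in\mathbb C^N$ let $\mathcal H(x,d)\in\mathbb C^{N\times d}$ be the wrap-around Hankel matrix with entries $x_{i+j}$ ($0\le j<d$), and for a filter $h$ of length $l$ let $(x\circledast h)_i=\sum_{k<l}h_kx_{i-k}$. For a nonzero subspace $U\subseteq\mathbb C^m$ with orthogonal projection $P_U$ let $\mu(U)=\frac{m}{\dim U}\max_i\|P_Ue_i\|^2$, and $\mu(0)=0$. **Networks.** Let $\mathrm{CNN}_\theta(\xi)\in\mathbb C^N$, $\mathrm{CNN}_\varphi(\zeta)\in\mathbb C^{l_1\times N_c}$, $\mathrm{CNN}_\psi(\eta)\in\mathbb C^{l_2}$ be three families of networks (arbitrary maps of their inputs, depending on the parameters $\theta,\varphi,\psi$), and let $$\mathcal G_{\theta,\varphi,\psi}(\xi,\zeta,\eta)=\big[\mathrm{CNN}_\theta(\xi)\circledast\mathrm{CNN}_\varphi(\zeta),\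 \overline{\mathrm{CNN}_\theta(\xi)}\circledast\mathrm{CNN}_\psi(\eta)\circledast\mathrm{CNN}_\varphi(\zeta)\big]\in\mathbb C^{N\times 2N_c},$$ the convolution with $\mathrm{CNN}_\varphi(\zeta)$ being taken with each of its $N_c$ columns. **Sampling.** Let $n$ locations $a_1,\dots,a_n\in\{1,\dots,N\}$ be sampled at random, either independently and uniformly, or (when $n\le N$) as a uniformly random sequence of distinct locations. Let $\mathcal M=\sum_{t=1}^ne_{a_t}e_{a_t}^{T}$, acting on the rows (so for distinct locations $\mathcal M$ is the $0/1$ mask with exactly $n$ nonzero diagonal entries; for independent draws a location counts as often as it was drawn). Let $x^*\in\mathbb C^{N\times N_c}$, let $\mathbf n\in\mathbb C^{N\times N_c}$ be noise (which may depend on the sampled locations), $y=\mathcal Mx^*+\mathbf n$, $X^*=[x^*,x^*]$ and $Y=[y,y]$. **Optimal network.** For each outcome of the sampling let $(\theta^*,\varphi^*,\psi^*)$ and $\Xi=(\xi,\zeta,\eta)\in B(s)^3$ be such that $(\theta^*,\varphi^*,\psi^*)$ minimizes $\|\mathcal M\mathcal G_{\theta,\varphi,\psi}(\Xi)-Y\|_F^2$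 over all parameters and $\Xi$ minimizes $\|\mathcal M\mathcal G(\cdot)-Y\|_F$ over $B(s)^3$, where $\mathcal G=\mathcal G_{\theta^*,\varphi^*,\psi^*}$; they may depend on the outcome. Let $\tilde X=\mathcal G(\tilde\xi,\zeta,\eta)$, $\tilde\xi\in B(s)$, be a minimizer of $\|X-X^*\|_F$ over $X\in\mathcal G(B(s),\zeta,\eta)$. **Assumptions.** For each outcome, $\operatorname{rank}\mathcal H(\mathrm{CNN}_{\theta^*}(\xi_1)-\mathrm{CNN}_{\theta^*}(\xi_2),d)\le r$ for all $\xi_1,\xi_2\in B(s)$, where $r<d$; and $\mu_0\ge\max\{\mu(U),\mu(V)\}$, where $U\subseteq\mathbb C^N$ and $V\subseteq\mathbb C^d$ are the spans of the left and of the right singular vectors, for the nonzero singular values, of $\mathcal H(\mathrm{CNN}_{\theta^*}(\xi)-\mathrm{CNN}_{\theta^*}(\tilde\xi),d)$. **Conclusion.** If $n>5.34\,\mu_0r(N+d)\beta\log d$, then $$c_1:=\frac nN-\sqrt{\frac{16\,n\,\mu_0r(N+d)\beta\log d}{3N^2}}>0,$$ and with probability at least $1-2d^{2-2\beta}$ $$\|\mathcal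 G(\Xi)-X^*\|_F\le\|\tilde X-X^*\|_F+\frac{2\|\mathcal M(\tilde X-X^*)\|_F+4\|\mathbf n\|_F}{c_1}.$$ -/

import Mathlib

open scoped Matrix Matrix.Norms.Frobenius

noncomputable section

namespace KSpace

/-- The wrap-around Hankel matrix of width `d` of a vector `x` of length `N`: its `(i, j)` entry is
`x_{i+j}`, with indices modulo `N`. -/
def hankel {N : ℕ} [NeZero N] (d : ℕ) (x : Fin N → ℂ) : Matrix (Fin N) (Fin d) ℂ :=
  Matrix.of fun i j => x (i + Fin.ofNat N j)

/-- Circular convolution (indices modulo `N`) of a vector of length `N` with a filter of length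
`l`. -/
def cconv {N : ℕ} [NeZero N] {l : ℕ} (x : Fin N → ℂ) (h : Fin l → ℂ) : Fin N → ℂ :=
  fun i => ∑ k : Fin l, h k * x (i - Fin.ofNat N k)

/-- Convolution is multiplication of the Hankel matrix with the flipped filter (the first entry of
the product being the entry of index `d - 1` of the convolution). -/
theorem hankel_mulVec_flip {N : ℕ} [NeZero N] {d : ℕ} (x : Fin N → ℂ) (h : Fin d → ℂ) (i : Fin N) :
    (hankel d x *ᵥ fun j => h j.rev) i = cconv x h (i + Fin.ofNat N (d - 1)) := by
  simp only [hankel, cconv, Matrix.mulVec, dotProduct, Matrix.of_apply]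
  rw [← Equiv.sum_comp Fin.revPerm]
  refine Finset.sum_congr rfl fun k _ => ?_
  have hk : (k.rev : ℕ) + k = d - 1 := by rw [Fin.val_rev]; omega
  have e : Fin.ofNat N (d - 1) = Fin.ofNat N (k.rev : ℕ) + Fin.ofNat N (k : ℕ) := by
    rw [← hk]; ext; simp [Fin.val_add]
  rw [e, Fin.revPerm_apply, Fin.rev_rev, ← add_assoc, add_sub_cancel_right, mul_comm]

/-- The coherence `(m / dim U) * max_i ‖P_U e_i‖ ^ 2` of a subspace `U` of `ℂ ^ m`
(it is `0` for the zero subspace). -/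
def coherence {m : ℕ} (U : Submodule ℂ (EuclideanSpace ℂ (Fin m))) : ℝ :=
  (m : ℝ) / (Module.finrank ℂ U : ℝ) *
    ⨆ i : Fin m, ‖U.starProjection (EuclideanSpace.single i (1 : ℂ))‖ ^ 2

/-- The span of the left singular vectors of `A` belonging to its nonzero singular values, that is,
the column space of `A`. -/
def leftSpace {m d : ℕ} (A : Matrix (Fin m) (Fin d) ℂ) :
    Submodule ℂ (EuclideanSpace ℂ (Fin m)) :=
  LinearMap.range (Matrix.toEuclideanLin A)

/-- The span of the right singular vectors of `A` belonging to its nonzero singular values, that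
is, the column space of the conjugate transpose of `A`. -/
def rightSpace {m d : ℕ} (A : Matrix (Fin m) (Fin d) ℂ) :
    Submodule ℂ (EuclideanSpace ℂ (Fin d)) :=
  LinearMap.range (Matrix.toEuclideanLin Aᴴ)

/-- The sampling operator of the locations `a 0, …, a (n - 1)`: it multiplies row `i` by the number
of times that `i` was sampled. For pairwise distinct locations it is the mask that keeps the sampled
rows and puts the others to zero. -/
def sample {N n : ℕ} {κ : Type*} (a : Fin n → Fin N) (X : Matrix (Fin N) κ ℂ) :
    Matrix (Fin N) κ ℂ :=
  Matrix.of fun i j => ((Finset.univ.filter fun t => a t = i).card : ℂ) * X i j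

/-- Three parametrized networks, with parameter sets `Θ`, `Φ`, `Ψ`: one generates the image in
`k`-space, one the `Nc` coil sensitivity filters of length `l₁` (as columns), one the phase filter of
length `l₂`. -/
structure Networks (Θ Φ Ψ : Type*) (p₁ p₂ p₃ N Nc l₁ l₂ : ℕ) where
  /-- the image network -/
  img : Θ → EuclideanSpace ℂ (Fin p₁) → Fin N → ℂ
  /-- the coil sensitivity network -/
  coil : Φ → EuclideanSpace ℂ (Fin p₂) → Matrix (Fin l₁) (Fin Nc) ℂ
  /-- the phase network -/
  phase : Ψ → EuclideanSpace ℂ (Fin p₃) → Fin l₂ → ℂ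

section

variable {Θ Φ Ψ : Type*} {p₁ p₂ p₃ N Nc l₁ l₂ : ℕ} [NeZero N]

/-- The tripled network
`[img ⊛ coil, conj img ⊛ phase ⊛ coil]`, convolved coil by coil. -/
def Networks.gen (F : Networks Θ Φ Ψ p₁ p₂ p₃ N Nc l₁ l₂) (θ : Θ) (φ : Φ) (ψ : Ψ)
    (ξ : EuclideanSpace ℂ (Fin p₁)) (ζ : EuclideanSpace ℂ (Fin p₂))
    (η : EuclideanSpace ℂ (Fin p₃)) : Matrix (Fin N) (Fin Nc ⊕ Fin Nc) ℂ :=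
  Matrix.fromCols
    (Matrix.of fun i c => cconv (F.img θ ξ) (fun k => F.coil φ ζ k c) i)
    (Matrix.of fun i c =>
      cconv (cconv (star (F.img θ ξ)) (F.phase ψ η)) (fun k => F.coil φ ζ k c) i)

/-- The training loss `‖M G(Ξ) - Y‖_F ^ 2` for data `Y = [y, y]` at the locations `a`. -/
def Networks.loss {n : ℕ} (F : Networks Θ Φ Ψ p₁ p₂ p₃ N Nc l₁ l₂) (a : Fin n → Fin N)
    (y : Matrix (Fin N) (Fin Nc) ℂ) (θ : Θ) (φ : Φ) (ψ : Ψ)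
    (ξ : EuclideanSpace ℂ (Fin p₁)) (ζ : EuclideanSpace ℂ (Fin p₂))
    (η : EuclideanSpace ℂ (Fin p₃)) : ℝ :=
  ‖sample a (F.gen θ φ ψ ξ ζ η) - Matrix.fromCols y y‖ ^ 2

/-- The parameters minimize the loss for the input `(ξ, ζ, η)`, and for these parameters the input
minimizes the loss over `B(s) ^ 3`. -/
def Networks.IsOptimal {n : ℕ} (F : Networks Θ Φ Ψ p₁ p₂ p₃ N Nc l₁ l₂) (s : ℝ) (a : Fin n → Fin N)
    (y : Matrix (Fin N) (Fin Nc) ℂ) (θ : Θ) (φ : Φ) (ψ : Ψ)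
    (ξ : EuclideanSpace ℂ (Fin p₁)) (ζ : EuclideanSpace ℂ (Fin p₂))
    (η : EuclideanSpace ℂ (Fin p₃)) : Prop :=
  (‖ξ‖ ≤ s ∧ ‖ζ‖ ≤ s ∧ ‖η‖ ≤ s) ∧
  (∀ θ' φ' ψ', F.loss a y θ φ ψ ξ ζ η ≤ F.loss a y θ' φ' ψ' ξ ζ η) ∧
  (∀ ξ' ζ' η', ‖ξ'‖ ≤ s → ‖ζ'‖ ≤ s → ‖η'‖ ≤ s →
    F.loss a y θ φ ψ ξ ζ η ≤ F.loss a y θ φ ψ ξ' ζ' η')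

/-- The Hankel matrix of the difference of two outputs of the image network. -/
def Networks.diffHankel (F : Networks Θ Φ Ψ p₁ p₂ p₃ N Nc l₁ l₂) (d : ℕ) (θ : Θ)
    (ξ ξ' : EuclideanSpace ℂ (Fin p₁)) : Matrix (Fin N) (Fin d) ℂ :=
  hankel d (F.img θ ξ - F.img θ ξ')

/-- Rank-deficiency: all Hankel differences of the image network on `B(s)` have rank at most `r`,
and `r < d`. -/
def Networks.RankDeficient (F : Networks Θ Φ Ψ p₁ p₂ p₃ N Nc l₁ l₂) (s : ℝ) (d r : ℕ) (θ : Θ) :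
    Prop :=
  (∀ ξ ξ', ‖ξ‖ ≤ s → ‖ξ'‖ ≤ s → (F.diffHankel d θ ξ ξ').rank ≤ r) ∧ r < d

end

/-- The constant `c₁ = n / N - √(16 n μ₀ r (N + d) β log d / (3 N²))`. -/
def c₁ (n N d r : ℕ) (μ₀ β : ℝ) : ℝ :=
  (n : ℝ) / N - √(16 * n * μ₀ * r * (N + d) * β * Real.log d / (3 * (N : ℝ) ^ 2))

end KSpace

end

/-! Let `X` be the difference between the optimal output and the best approximation with the same
`ζ` and `η`. Each column of `X` is a polynomial in the cyclic shift applied to the difference `z` of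
two images, up to complex conjugation of the column. A Hankel matrix of rank below `d` has a
shift-invariant column space, so these columns (conjugated where needed) lie in `leftSpace (hankel d
z)`, of dimension at most `r` and coherence at most `μ₀`. Hence every row of `X` carries at most the
fraction `μ₀ * r / N` of `‖X‖ ^ 2` (`Networks.row_gen_sub_le`).

For independent draws, one event controls all such flat matrices at once: that `∑ i, exp (-(l * hits
a i))` is not much above its mean bound. Jensen's inequality then gives `c₁ * ‖X‖ ≤ ‖sample a X‖`
(`c₁_mul_norm_le_norm_sample`), and Markov's inequality bounds the failure probability. Since the
event does not refer to `X`, the networks and the noise may depend on the sample. Optimality bounds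
`‖sample a X‖` by the approximation error and the noise (`Networks.IsOptimal.norm_sample_sub_le`),
and the triangle inequality concludes.

Distinct locations need no probability. If `μ₀ * r < 1`, flatness forces `X = 0`; otherwise the
lower bound on `n` gives `n > N`, which excludes them. -/

namespace KSpace

/-! ### Exponential moments of the hit counts. -/

section Probability

variable {n N : ℕ}

/-- The number of times that the location `i` occurs in the sequence `a`. -/
def hits (a : Fin n → Fin N) (i : Fin N) : ℕ := (Finset.univ.filter fun t => a t = i).card

/-- The generating function of a binomial count: the power factors over the draws, and each draw
contributes `b` at `i` and `1` at the other `N - 1` locations. -/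
theorem sum_pow_hits (b : ℝ) (i : Fin N) :
    ∑ a : Fin n → Fin N, b ^ hits a i = ((N : ℝ) - 1 + b) ^ n := by
  have h1 : ∀ a : Fin n → Fin N, b ^ hits a i = ∏ t, if a t = i then b else 1 := by
    intro a
    rw [Finset.prod_ite, Finset.prod_const, Finset.prod_const_one, mul_one, hits]
  have h2 : ∑ k : Fin N, (if k = i then b else 1) = (N : ℝ) - 1 + b := by
    have : ∀ k : Fin N, (if k = i then b else (1 : ℝ)) = 1 + if k = i then b - 1 else 0 := by
      intro k; split_ifs <;> ring
    simp only [this, Finset.sum_add_distrib]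
    simp
    ring
  simp_rw [h1]
  rw [← h2, Fintype.sum_pow]

theorem sum_exp_neg_hits_le [NeZero N] (l : ℝ) (i : Fin N) :
    ∑ a : Fin n → Fin N, Real.exp (-(l * hits a i)) ≤
      (N : ℝ) ^ n * Real.exp (-((n : ℝ) / N * (1 - Real.exp (-l)))) := by
  have hN : (0 : ℝ) < N := by exact_mod_cast Nat.pos_of_ne_zero (NeZero.ne N)
  have hN1 : (1 : ℝ) ≤ N := by exact_mod_cast Nat.pos_of_ne_zero (NeZero.ne N)
  have h1 : ∀ a : Fin n → Fin N, Real.exp (-(l * hits a i)) = Real.exp (-l) ^ hits a i := by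
    intro a
    rw [← Real.exp_nat_mul]; ring_nf
  simp_rw [h1]
  rw [sum_pow_hits]
  -- This is `1 + u ≤ exp u` at `u = -(1 - exp (-l)) / N`; its `n`-th power is the Poisson-type
  -- bound.
  have h2 : (N : ℝ) - 1 + Real.exp (-l) ≤ N * Real.exp (-((1 - Real.exp (-l)) / N)) := by
    have := Real.add_one_le_exp (-((1 - Real.exp (-l)) / N))
    calc (N : ℝ) - 1 + Real.exp (-l) = N * (-((1 - Real.exp (-l)) / N) + 1) := by
          field_simp; ring
      _ ≤ _ := by gcongr
  calc ((N : ℝ) - 1 + Real.exp (-l)) ^ n ≤ (N * Real.exp (-((1 - Real.exp (-l)) / N))) ^ n := by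
        have := Real.exp_pos (-l)
        gcongr
    _ = _ := by
        rw [mul_pow, ← Real.exp_nat_mul]
        congr 2
        field_simp

/-- The uniform distribution on all sequences, by counting the exceptional ones. -/
theorem one_sub_le_uniformOn_univ [NeZero N] {S : Set (Fin n → Fin N)} {δ : ℝ}
    (B : Finset (Fin n → Fin N)) (hB : ∀ a, a ∉ B → a ∈ S) (hcard : (B.card : ℝ) ≤ δ * (N : ℝ) ^ n) :
    1 - δ ≤ (ProbabilityTheory.uniformOn (Set.univ : Set (Fin n → Fin N))).real S := by
  have hN : (0 : ℝ) < (N : ℝ) ^ n := by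
    have : (0 : ℝ) < N := by exact_mod_cast Nat.pos_of_ne_zero (NeZero.ne N)
    positivity
  have := ProbabilityTheory.isProbabilityMeasure_uniformOn
    (Set.finite_univ (α := Fin n → Fin N)) Set.univ_nonempty
  have hB' : (ProbabilityTheory.uniformOn (Set.univ : Set (Fin n → Fin N))).real (B : Set _) ≤ δ := by
    rw [MeasureTheory.measureReal_def, ProbabilityTheory.uniformOn_univ,
      MeasureTheory.Measure.count_apply_finset]
    simp only [ENNReal.toReal_div, ENNReal.toReal_natCast, ENNReal.toReal_pow, Fintype.card_pi, Fintype.card_fin,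
      Finset.prod_const, Finset.card_univ, Nat.cast_pow]
    rwa [div_le_iff₀ hN]
  have hc := MeasureTheory.probReal_compl_eq_one_sub
    (μ := ProbabilityTheory.uniformOn (Set.univ : Set (Fin n → Fin N)))
    (s := (B : Set (Fin n → Fin N))) B.measurableSet
  have hm : (ProbabilityTheory.uniformOn (Set.univ : Set (Fin n → Fin N))).real (B : Set _)ᶜ ≤
      (ProbabilityTheory.uniformOn (Set.univ : Set (Fin n → Fin N))).real S :=
    MeasureTheory.measureReal_mono (fun a ha => hB a (by simpa using ha))
  linarith

/-- Markov's inequality for the exponential moment of the hit counts, averaged over locations. -/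
theorem uniformOn_univ_of_sum_exp_lt [NeZero N] {S : Set (Fin n → Fin N)} {l δ : ℝ}
    (hδ : 0 < δ)
    (hS : ∀ a : Fin n → Fin N, ∑ i, Real.exp (-(l * hits a i)) <
      N * Real.exp (-((n : ℝ) / N * (1 - Real.exp (-l)))) / δ → a ∈ S) :
    1 - δ ≤ (ProbabilityTheory.uniformOn (Set.univ : Set (Fin n → Fin N))).real S := by
  classical
  have hN : (0 : ℝ) < N := by exact_mod_cast Nat.pos_of_ne_zero (NeZero.ne N)
  set T := (N : ℝ) * Real.exp (-((n : ℝ) / N * (1 - Real.exp (-l)))) with hT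
  have hTpos : 0 < T := by positivity
  refine one_sub_le_uniformOn_univ
    (Finset.univ.filter fun a => T / δ ≤ ∑ i, Real.exp (-(l * hits a i)))
    (fun a ha => hS a (by simpa using ha)) ?_
  set B := Finset.univ.filter fun a : Fin n → Fin N => T / δ ≤ ∑ i, Real.exp (-(l * hits a i))
  have h1 : (B.card : ℝ) * (T / δ) ≤ ∑ a : Fin n → Fin N, ∑ i, Real.exp (-(l * hits a i)) := by
    rw [← nsmul_eq_mul]
    refine (Finset.card_nsmul_le_sum B (fun a => ∑ i, Real.exp (-(l * hits a i))) _
      (fun a ha => (Finset.mem_filter.1 ha).2)).trans ?_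
    exact Finset.sum_le_sum_of_subset_of_nonneg (Finset.subset_univ _) (fun a _ _ => by positivity)
  have h2 : ∑ a : Fin n → Fin N, ∑ i, Real.exp (-(l * hits a i)) ≤ (N : ℝ) ^ n * T := by
    rw [Finset.sum_comm]
    refine (Finset.sum_le_sum fun i _ => sum_exp_neg_hits_le l i).trans ?_
    simp only [Finset.sum_const, Finset.card_univ, Fintype.card_fin, nsmul_eq_mul, hT]
    apply le_of_eq; ring
  have h3 := h1.trans h2
  rw [← mul_div_assoc, div_le_iff₀ hδ] at h3
  refine le_of_mul_le_mul_right ?_ hTpos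
  linarith

theorem exp_neg_le_quadratic {l : ℝ} (hl : 0 ≤ l) : Real.exp (-l) ≤ 1 - l + l ^ 2 / 2 := by
  have h := Real.quadratic_le_exp_of_nonneg hl
  rw [Real.exp_neg, inv_le_iff_one_le_mul₀ (Real.exp_pos l)]
  have h0 : 0 ≤ 1 - l + l ^ 2 / 2 := by nlinarith [sq_nonneg (l - 1)]
  nlinarith [mul_le_mul_of_nonneg_left h h0, pow_nonneg hl 4]

/-- Flat weights see almost the mean number of hits, if the exponential moment is small. -/
theorem le_sum_weights_mul {ι : Type*} [Fintype ι] {p c : ι → ℝ} {l Q K : ℝ} (hl : 0 < l)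
    (hp : ∀ i, 0 ≤ p i) (hsum : ∑ i, p i = 1) (hpQ : ∀ i, p i ≤ Q) (hQ : 0 < Q)
    (hK : ∑ i, Real.exp (-(l * c i)) ≤ K) :
    -Real.log (Q * K) / l ≤ ∑ i, p i * c i := by
  -- Jensen for `exp` moves the weights outside the exponential, where only their upper bound `Q`
  -- matters; the result is therefore uniform in `p`.
  have h1 := convexOn_exp.map_sum_le (t := Finset.univ) (w := p) (p := fun i => -(l * c i))
    (fun i _ => hp i) hsum (fun i _ => Set.mem_univ _)
  simp only [smul_eq_mul] at h1
  have h2 : ∑ i, p i * Real.exp (-(l * c i)) ≤ Q * K := by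
    refine le_trans (Finset.sum_le_sum fun i _ =>
      mul_le_mul_of_nonneg_right (hpQ i) (Real.exp_pos _).le) ?_
    rw [← Finset.mul_sum]
    gcongr
  have h3 := Real.le_log_iff_exp_le (lt_of_lt_of_le (Real.exp_pos _) (h1.trans h2)) |>.2 (h1.trans h2)
  have h4 : ∑ i, p i * -(l * c i) = -(l * ∑ i, p i * c i) := by
    rw [Finset.mul_sum, ← Finset.sum_neg_distrib]
    exact Finset.sum_congr rfl fun i _ => by ring
  rw [div_le_iff₀ hl]
  linarith

end Probability

/-! ### Convolutions as polynomials in the cyclic shift. -/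

section Shift

variable {N : ℕ} [NeZero N]

/-- The cyclic shift of a vector by one index. -/
def shift (N : ℕ) [NeZero N] : Module.End ℂ (Fin N → ℂ) :=
  LinearMap.funLeft ℂ ℂ fun i => i + Fin.ofNat N 1

theorem shift_pow_apply (m : ℕ) (x : Fin N → ℂ) (i : Fin N) :
    (shift N ^ m) x i = x (i + Fin.ofNat N m) := by
  induction m generalizing i with
  | zero => simp
  | succ k ih =>
    rw [pow_succ', Module.End.mul_apply, shift, LinearMap.funLeft_apply, ← shift, ih]
    congr 1
    ext
    simp only [Fin.val_add, Fin.val_ofNat, Nat.add_mod_mod, Nat.mod_add_mod]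
    congr 1
    ring

/-- The filter shifts backwards; as the shift has order dividing `N`, its inverse is its power `N -
1`, which keeps the exponents natural. -/
theorem cconv_eq_aeval {l : ℕ} (x : Fin N → ℂ) (h : Fin l → ℂ) :
    cconv x h = Polynomial.aeval (shift N)
      (∑ k : Fin l, Polynomial.monomial ((N - 1) * (k : ℕ)) (h k)) x := by
  ext i
  rw [map_sum, LinearMap.sum_apply, Finset.sum_apply, cconv]
  refine Finset.sum_congr rfl fun k _ => ?_
  rw [Polynomial.aeval_monomial, Module.End.mul_apply, Module.algebraMap_end_apply, Pi.smul_apply,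
    shift_pow_apply, smul_eq_mul]
  congr 2
  rw [sub_eq_add_neg]
  congr 1
  rw [neg_eq_iff_add_eq_zero]
  ext
  have : (k : ℕ) + (N - 1) * k = N * k := by
    have := Nat.pos_of_ne_zero (NeZero.ne N)
    obtain ⟨M, rfl⟩ : ∃ M, N = M + 1 := ⟨N - 1, by omega⟩
    simp; ring
  simp [Fin.val_add, this]

theorem mulVec_hankel {d : ℕ} (x : Fin N → ℂ) (v : Fin d → ℂ) :
    hankel d x *ᵥ v = Polynomial.aeval (shift N)
      (∑ j : Fin d, Polynomial.monomial (j : ℕ) (v j)) x := by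
  ext i
  rw [map_sum, LinearMap.sum_apply, Finset.sum_apply, Matrix.mulVec, dotProduct]
  refine Finset.sum_congr rfl fun k _ => ?_
  rw [Polynomial.aeval_monomial, Module.End.mul_apply, Module.algebraMap_end_apply, Pi.smul_apply,
    shift_pow_apply, smul_eq_mul, hankel, Matrix.of_apply, mul_comm]

/-- A wrap-around Hankel matrix without full column rank has a shift-invariant column space. -/
theorem aeval_shift_mem_range {d : ℕ} {x : Fin N → ℂ} (hx : (hankel d x).rank < d)
    (f : Polynomial ℂ) : ∃ v, hankel d x *ᵥ v = Polynomial.aeval (shift N) f x := by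
  -- A linear dependence between the columns gives the coefficients of a nonzero polynomial `P` of
  -- degree below `d` that annihilates `x`.
  obtain ⟨c, hc0, hc⟩ : ∃ c : Fin d → ℂ, c ≠ 0 ∧ hankel d x *ᵥ c = 0 := by
    by_contra! hcon
    have hinj : Function.Injective (hankel d x).mulVecLin := by
      rw [← LinearMap.ker_eq_bot, LinearMap.ker_eq_bot']
      intro m hm
      by_contra h
      exact hcon m h hm
    have := LinearMap.finrank_range_of_inj hinj
    rw [Module.finrank_fin_fun] at this
    exact absurd (this : (hankel d x).rank = d) hx.ne
  set P : Polynomial ℂ := ∑ j : Fin d, Polynomial.monomial (j : ℕ) (c j) with hP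
  have hcoeff : ∀ j : Fin d, P.coeff j = c j := by
    intro j
    rw [hP, Polynomial.finsetSum_coeff]
    simp [Polynomial.coeff_monomial, Fin.val_inj]
  have hP0 : P ≠ 0 := by
    intro h
    apply hc0
    ext j
    rw [← hcoeff j, h]; simp
  have hPd : P.degree < d := by
    rw [hP]
    simp only [← Polynomial.C_mul_X_pow_eq_monomial]
    exact Polynomial.degree_sum_fin_lt c
  have hPx : Polynomial.aeval (shift N) P x = 0 := by rw [hP, ← mulVec_hankel, hc]
  have hdeg : (f % P).degree < d := (Polynomial.degree_mod_lt f hP0).trans hPd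
  -- Modulo `P`, the action of `f` on `x` is that of its remainder, whose `d` coefficients form the
  -- required vector.
  refine ⟨fun j => (f % P).coeff j, ?_⟩
  rw [mulVec_hankel]
  have h1 : ∑ j : Fin d, Polynomial.monomial (j : ℕ) ((f % P).coeff j) = f % P := by
    rw [Fin.sum_univ_eq_sum_range fun j => Polynomial.monomial j ((f % P).coeff j)]
    by_cases h0 : f % P = 0
    · simp [h0]
    · exact ((f % P).as_sum_range' d ((Polynomial.natDegree_lt_iff_degree_lt h0).2 hdeg)).symm
  rw [h1]
  conv_rhs => rw [← EuclideanDomain.div_add_mod f P]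
  rw [map_add, mul_comm, map_mul, LinearMap.add_apply, Module.End.mul_apply, hPx, map_zero,
    zero_add]

theorem star_cconv {l : ℕ} (x : Fin N → ℂ) (h : Fin l → ℂ) :
    star (cconv x h) = cconv (star x) (star h) := by
  ext i
  simp [cconv, Pi.star_apply]

theorem cconv_sub {l : ℕ} (x y : Fin N → ℂ) (h : Fin l → ℂ) :
    cconv (x - y) h = cconv x h - cconv y h := by
  simp only [cconv_eq_aeval, map_sub]

end Shift

/-! ### Incoherent subspaces contain only spread-out vectors. -/

section Coherence

theorem coherence_nonneg {m : ℕ} (U : Submodule ℂ (EuclideanSpace ℂ (Fin m))) :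
    0 ≤ coherence U := by
  unfold coherence
  exact mul_nonneg (by positivity) (Real.iSup_nonneg fun i => by positivity)

/-- The entries of the vectors of an incoherent subspace are small. -/
theorem norm_sq_apply_le_coherence {m : ℕ} {U : Submodule ℂ (EuclideanSpace ℂ (Fin m))}
    {w : EuclideanSpace ℂ (Fin m)} (hw : w ∈ U) (i : Fin m) :
    ‖w i‖ ^ 2 ≤ coherence U * Module.finrank ℂ U / m * ‖w‖ ^ 2 := by
  by_cases hU : Module.finrank ℂ U = 0
  · rw [Submodule.finrank_eq_zero] at hU
    subst hU
    rw [Submodule.mem_bot] at hw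
    simp [hw]
  have hm : (m : ℝ) ≠ 0 := by exact_mod_cast i.pos.ne'
  have h1 : w i = inner ℂ (U.starProjection (EuclideanSpace.single i (1 : ℂ))) w := by
    rw [Submodule.inner_starProjection_left_eq_right, Submodule.starProjection_eq_self_iff.2 hw,
      EuclideanSpace.inner_single_left]
    simp
  have h2 : ‖w i‖ ≤ ‖U.starProjection (EuclideanSpace.single i (1 : ℂ))‖ * ‖w‖ := by
    rw [h1]; exact norm_inner_le_norm _ _
  have h3 : ‖U.starProjection (EuclideanSpace.single i (1 : ℂ))‖ ^ 2 ≤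
      ⨆ i : Fin m, ‖U.starProjection (EuclideanSpace.single i (1 : ℂ))‖ ^ 2 :=
    le_ciSup (f := fun i : Fin m => ‖U.starProjection (EuclideanSpace.single i (1 : ℂ))‖ ^ 2)
      (Set.finite_range _).bddAbove i
  have h4 : coherence U * Module.finrank ℂ U / m =
      ⨆ i : Fin m, ‖U.starProjection (EuclideanSpace.single i (1 : ℂ))‖ ^ 2 := by
    have : (Module.finrank ℂ U : ℝ) ≠ 0 := by exact_mod_cast hU
    unfold coherence
    field_simp
  rw [h4]
  calc ‖w i‖ ^ 2 ≤ (‖U.starProjection (EuclideanSpace.single i (1 : ℂ))‖ * ‖w‖) ^ 2 := by gcongr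
    _ = ‖U.starProjection (EuclideanSpace.single i (1 : ℂ))‖ ^ 2 * ‖w‖ ^ 2 := by ring
    _ ≤ _ := by gcongr

theorem finrank_leftSpace {m d : ℕ} (A : Matrix (Fin m) (Fin d) ℂ) :
    Module.finrank ℂ (leftSpace A) = A.rank := by
  rw [leftSpace, Matrix.rank_eq_finrank_range_toLin A (PiLp.basisFun 2 ℂ _)
    (PiLp.basisFun 2 ℂ _), ← Matrix.toLpLin_eq_toLin]

/-- Convolutions `w` of a vector with a rank-deficient Hankel matrix are spread out. -/
theorem norm_sq_aeval_shift_apply_le {N d r : ℕ} [NeZero N] {x : Fin N → ℂ} {μ₀ : ℝ}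
    (hr : (hankel d x).rank ≤ r) (hrd : r < d) (hμ : coherence (leftSpace (hankel d x)) ≤ μ₀)
    (f : Polynomial ℂ) (i : Fin N) :
    ‖Polynomial.aeval (shift N) f x i‖ ^ 2 ≤
      μ₀ * r / N * ∑ k, ‖Polynomial.aeval (shift N) f x k‖ ^ 2 := by
  obtain ⟨v, hv⟩ := aeval_shift_mem_range (hr.trans_lt hrd) f
  have hmem : WithLp.toLp 2 (Polynomial.aeval (shift N) f x) ∈ leftSpace (hankel d x) := by
    refine ⟨WithLp.toLp 2 v, ?_⟩
    rw [← hv]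
    rfl
  have h := norm_sq_apply_le_coherence hmem i
  rw [EuclideanSpace.norm_sq_eq, finrank_leftSpace] at h
  refine h.trans ?_
  have := coherence_nonneg (leftSpace (hankel d x))
  gcongr
  exact this.trans hμ

end Coherence

/-! ### Frobenius norms of sampled matrices. -/

section Frobenius

theorem frobenius_norm_sq {m κ : Type*} [Fintype m] [Fintype κ] (A : Matrix m κ ℂ) :
    ‖A‖ ^ 2 = ∑ i, ∑ j, ‖A i j‖ ^ 2 := by
  rw [Matrix.frobenius_norm_def, ← Real.sqrt_eq_rpow, Real.sq_sqrt (by positivity)]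
  simp

theorem norm_fromCols_self {m κ : Type*} [Fintype m] [Fintype κ] (A : Matrix m κ ℂ) :
    ‖Matrix.fromCols A A‖ ≤ 2 * ‖A‖ := by
  refine le_of_sq_le_sq ?_ (by positivity)
  rw [mul_pow, frobenius_norm_sq, frobenius_norm_sq A]
  simp only [Fintype.sum_sum_type, Matrix.fromCols_apply_inl, Matrix.fromCols_apply_inr,
    Finset.sum_add_distrib]
  have : 0 ≤ ∑ i, ∑ j, ‖A i j‖ ^ 2 := by positivity
  linarith

theorem sample_sub {N n : ℕ} {κ : Type*} (a : Fin n → Fin N) (X Y : Matrix (Fin N) κ ℂ) :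
    sample a (X - Y) = sample a X - sample a Y := by
  ext i j
  simp [sample, mul_sub]

theorem norm_sample_sq {N n : ℕ} {κ : Type*} [Fintype κ] (a : Fin n → Fin N)
    (X : Matrix (Fin N) κ ℂ) :
    ‖sample a X‖ ^ 2 = ∑ i, (hits a i : ℝ) ^ 2 * ∑ j, ‖X i j‖ ^ 2 := by
  rw [frobenius_norm_sq]
  simp only [sample, Matrix.of_apply, norm_mul, mul_pow, Finset.mul_sum, Complex.norm_natCast, hits]

/-- A matrix is sampled with the average number of hits of its rows. -/
theorem sum_hits_mul_le_norm_sample {N n : ℕ} {κ : Type*} [Fintype κ] (a : Fin n → Fin N)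
    {X : Matrix (Fin N) κ ℂ} (hX : X ≠ 0) :
    (∑ i, (∑ j, ‖X i j‖ ^ 2) / ‖X‖ ^ 2 * hits a i) * ‖X‖ ≤ ‖sample a X‖ := by
  have hX0 : 0 < ‖X‖ := norm_pos_iff.2 hX
  refine le_of_sq_le_sq ?_ (norm_nonneg _)
  rw [mul_pow, norm_sample_sq]
  -- Jensen for the square: the squared mean of the hits is at most the mean of their squares, which
  -- is `‖sample a X‖ ^ 2 / ‖X‖ ^ 2`.
  have h := (even_two.convexOn_pow (𝕜 := ℝ)).map_sum_le (t := Finset.univ)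
    (w := fun i => (∑ j, ‖X i j‖ ^ 2) / ‖X‖ ^ 2) (p := fun i => (hits a i : ℝ))
    (fun i _ => by positivity)
    (by rw [← Finset.sum_div, ← frobenius_norm_sq, div_self (by positivity)])
    (fun i _ => Set.mem_univ _)
  simp only [smul_eq_mul] at h
  calc _ ≤ (∑ i, (∑ j, ‖X i j‖ ^ 2) / ‖X‖ ^ 2 * (hits a i : ℝ) ^ 2) * ‖X‖ ^ 2 := by gcongr
    _ = _ := by
      rw [Finset.sum_mul]
      refine Finset.sum_congr rfl fun i _ => ?_
      field_simp

end Frobenius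

/-! ### Flatness and optimality of the network outputs. -/

section Networks

variable {Θ Φ Ψ : Type*} {p₁ p₂ p₃ N Nc l₁ l₂ : ℕ} [NeZero N]

/-- The rows of the difference of two network outputs have small norm. -/
theorem Networks.row_gen_sub_le (F : Networks Θ Φ Ψ p₁ p₂ p₃ N Nc l₁ l₂) {d r : ℕ} {μ₀ : ℝ}
    {θ : Θ} (φ : Φ) (ψ : Ψ) {ξ ξ' : EuclideanSpace ℂ (Fin p₁)} (ζ : EuclideanSpace ℂ (Fin p₂))
    (η : EuclideanSpace ℂ (Fin p₃)) (hr : (F.diffHankel d θ ξ ξ').rank ≤ r) (hrd : r < d)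
    (hμ : coherence (leftSpace (F.diffHankel d θ ξ ξ')) ≤ μ₀) (i : Fin N) :
    ∑ j, ‖(F.gen θ φ ψ ξ ζ η - F.gen θ φ ψ ξ' ζ η) i j‖ ^ 2 ≤
      μ₀ * r / N * ‖F.gen θ φ ψ ξ ζ η - F.gen θ φ ψ ξ' ζ η‖ ^ 2 := by
  rw [frobenius_norm_sq, Finset.sum_comm, Finset.mul_sum]
  refine Finset.sum_le_sum fun j _ => ?_
  set z := F.img θ ξ - F.img θ ξ' with hz
  obtain ⟨f, hf⟩ : ∃ f : Polynomial ℂ, ∀ k,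
      ‖(F.gen θ φ ψ ξ ζ η - F.gen θ φ ψ ξ' ζ η) k j‖ = ‖Polynomial.aeval (shift N) f z k‖ := by
    rcases j with c | c
    · refine ⟨∑ k : Fin l₁, Polynomial.monomial ((N - 1) * (k : ℕ)) (F.coil φ ζ k c), fun k => ?_⟩
      rw [← cconv_eq_aeval z fun k => F.coil φ ζ k c, hz, cconv_sub]
      rfl
    -- In the conjugated half, each column is the conjugate of `z` convolved with the conjugated
    -- filters, so its entries have the same moduli.
    · refine ⟨(∑ k : Fin l₁, Polynomial.monomial ((N - 1) * (k : ℕ))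
          (star (fun k => F.coil φ ζ k c) k)) *
        ∑ k : Fin l₂, Polynomial.monomial ((N - 1) * (k : ℕ)) (star (F.phase ψ η) k), fun k => ?_⟩
      rw [map_mul, Module.End.mul_apply, ← cconv_eq_aeval, ← cconv_eq_aeval,
        ← star_star z, ← star_cconv, ← star_cconv, Pi.star_apply, norm_star, hz, star_sub,
        cconv_sub, cconv_sub]
      rfl
  simp only [hf]
  exact norm_sq_aeval_shift_apply_le hr hrd hμ f i

/-- Minimality over the inputs makes the residual at `ξ` at most that at `ξ'`, so the two together
cost twice the latter. The noise occurs in both halves of the data, and `‖[e, e]‖ ≤ 2 * ‖e‖` yields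
the factor `4`. -/
theorem Networks.IsOptimal.norm_sample_sub_le {n : ℕ} {F : Networks Θ Φ Ψ p₁ p₂ p₃ N Nc l₁ l₂}
    {s : ℝ} {a : Fin n → Fin N} {x e : Matrix (Fin N) (Fin Nc) ℂ} {θ : Θ} {φ : Φ} {ψ : Ψ}
    {ξ ξ' : EuclideanSpace ℂ (Fin p₁)} {ζ : EuclideanSpace ℂ (Fin p₂)}
    {η : EuclideanSpace ℂ (Fin p₃)} (h : F.IsOptimal s a (sample a x + e) θ φ ψ ξ ζ η)
    (hξ' : ‖ξ'‖ ≤ s) :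
    ‖sample a (F.gen θ φ ψ ξ ζ η - F.gen θ φ ψ ξ' ζ η)‖ ≤
      2 * ‖sample a (F.gen θ φ ψ ξ' ζ η - Matrix.fromCols x x)‖ + 4 * ‖e‖ := by
  obtain ⟨⟨-, hζ, hη⟩, -, hmin⟩ := h
  have h1 := le_of_sq_le_sq (hmin ξ' ζ η hξ' hζ hη) (norm_nonneg _)
  have hY : Matrix.fromCols (sample a x + e) (sample a x + e) =
      sample a (Matrix.fromCols x x) + Matrix.fromCols e e := by
    ext i j
    cases j <;> simp [sample]
  set Y := Matrix.fromCols (sample a x + e) (sample a x + e)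
  set G := F.gen θ φ ψ ξ ζ η
  set T := F.gen θ φ ψ ξ' ζ η
  have h2 : ‖sample a (G - T)‖ ≤ ‖sample a G - Y‖ + ‖sample a T - Y‖ := by
    rw [sample_sub, ← sub_sub_sub_cancel_right _ _ Y]
    exact norm_sub_le _ _
  have h3 : ‖sample a T - Y‖ ≤ ‖sample a (T - Matrix.fromCols x x)‖ + ‖Matrix.fromCols e e‖ := by
    rw [hY, ← sub_sub, ← sample_sub]
    exact norm_sub_le _ _
  have := norm_fromCols_self e
  linarith

end Networks

/-! ### The numerical constants. -/

section Constants

theorem c₁_eq {n N d r : ℕ} {μ₀ β : ℝ} :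
    c₁ n N d r μ₀ β = (n : ℝ) / N -
      √(16 / 3 * ((n : ℝ) / N) * (μ₀ * r * (N + d) * β * Real.log d / N)) := by
  rw [c₁]
  congr 2
  by_cases hN : (N : ℝ) = 0
  · simp [hN]
  · field_simp

/-- After squaring, the claim reduces to `16 / 3 * L < n`; the constant `5.34` is `16 / 3` rounded
up. -/
theorem c₁_pos {n N d r : ℕ} [NeZero N] {μ₀ β : ℝ} (hβ : 1 < β) (hμ : 0 ≤ μ₀)
    (hn : 5.34 * μ₀ * r * (N + d) * β * Real.log d < n) : 0 < c₁ n N d r μ₀ β := by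
  have hN : (0 : ℝ) < N := by exact_mod_cast Nat.pos_of_ne_zero (NeZero.ne N)
  have hL : 0 ≤ μ₀ * r * (N + d) * β * Real.log d :=
    mul_nonneg (by positivity) (Real.log_natCast_nonneg d)
  rw [c₁_eq, sub_pos, Real.sqrt_lt' (by have : (0 : ℝ) < n := by linarith
                                        positivity)]
  set L := μ₀ * r * (N + d) * β * Real.log d
  have hLn : 5.34 * L < n := by simpa only [L, mul_assoc] using hn
  have h1 : (n : ℝ) / N = n * (1 / N) := by ring
  calc 16 / 3 * ((n : ℝ) / N) * (L / N) = (16 / 3 * L) * n / N ^ 2 := by field_simp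
    _ < n * n / N ^ 2 := by
      have : (0 : ℝ) < n := by linarith
      gcongr
      linarith
    _ = _ := by field_simp

/-- The exponent at which the exponential moment of the hit counts is taken. -/
theorem le_of_exponent {m L q β D : ℝ} (hm : 0 < m) (hq : 1 ≤ q) (hβ : 1 < β)
    (hD : Real.log 2 ≤ D) (hL : q * β * D ≤ L) {l : ℝ} (hl : l = √(16 / 3 * m * L) / m) :
    0 < l ∧ (m - √(16 / 3 * m * L)) * l ≤
      m * (1 - Real.exp (-l)) - Real.log q + Real.log 2 + (2 - 2 * β) * D := by
  have hlog2 := Real.log_two_gt_d9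
  have hqβ : 0 < q * β * D := by
    have : 0 < D := by linarith
    positivity
  have hLpos : 0 < L := hqβ.trans_le hL
  set t := √(16 / 3 * m * L) with ht
  have htpos : 0 < t := Real.sqrt_pos.2 (by positivity)
  have ht2 : t ^ 2 = 16 / 3 * m * L := Real.sq_sqrt (by positivity)
  have hlpos : 0 < l := by rw [hl]; positivity
  have hml : m * l = t := by rw [hl]; field_simp
  have htl : t * l = 16 / 3 * L := by
    rw [hl, ← mul_div_assoc, ← sq, ht2]; field_simp
  refine ⟨hlpos, ?_⟩
  -- With `m * l = t` and `t * l = 16 / 3 * L`, the quadratic bound gives `m * (1 - exp (-l)) ≥ t -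
  -- 8 / 3 * L`, while the left side of the goal is `t - 16 / 3 * L`. The surplus `8 / 3 * L` has to
  -- absorb `log q` and `(2 * β - 2) * D`.
  have h1 := mul_le_mul_of_nonneg_left (exp_neg_le_quadratic hlpos.le) hm.le
  have h2 : Real.log q ≤ q - 1 := Real.log_le_sub_one_of_pos (by linarith)
  have h3 : m * (1 - l + l ^ 2 / 2) = m - t + 8 / 3 * L := by
    have : m * (1 - l + l ^ 2 / 2) = m - m * l + m * l * l / 2 := by ring
    rw [this, hml, htl]; ring
  have h4 : q - 1 + (2 * β - 2) * D ≤ 8 / 3 * (q * β * D) := by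
    have e1 : 0 ≤ (β - 1) * D * (q - 1) :=
      mul_nonneg (mul_nonneg (by linarith) (by linarith)) (by linarith)
    have e2 : 0 ≤ (β - 1) * D := mul_nonneg (by linarith) (by linarith)
    have e3 : q * 0.69 ≤ q * D := mul_le_mul_of_nonneg_left (by linarith) (by linarith)
    nlinarith
  have h5 : (m - t) * l = t - 16 / 3 * L := by rw [sub_mul, hml, htl]
  linarith

end Constants

/-! ### Sampling flat matrices. -/

section Main

/-- Sampling is bounded below on all matrices with flat rows, if the exponential moment of the hit
counts is small. -/
theorem c₁_mul_norm_le_norm_sample {n N d r : ℕ} [NeZero N] {κ : Type*} [Fintype κ] {μ₀ β l : ℝ}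
    (hβ : 1 < β) (hn : 0 < n) (hd : 2 ≤ d) (hq : 1 ≤ μ₀ * r)
    (hl : l = √(16 / 3 * ((n : ℝ) / N) * (μ₀ * r * (N + d) * β * Real.log d / N)) / (n / N))
    {a : Fin n → Fin N}
    (ha : ∑ i, Real.exp (-(l * hits a i)) <
      N * Real.exp (-((n : ℝ) / N * (1 - Real.exp (-l)))) / (2 * (d : ℝ) ^ (2 - 2 * β)))
    (X : Matrix (Fin N) κ ℂ) (hX : ∀ i, ∑ j, ‖X i j‖ ^ 2 ≤ μ₀ * r / N * ‖X‖ ^ 2) :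
    c₁ n N d r μ₀ β * ‖X‖ ≤ ‖sample a X‖ := by
  by_cases hX0 : X = 0
  · simp [hX0]
  refine le_trans (mul_le_mul_of_nonneg_right ?_ (norm_nonneg _))
    (sum_hits_mul_le_norm_sample a hX0)
  have hXpos : 0 < ‖X‖ := norm_pos_iff.2 hX0
  have hN : (0 : ℝ) < N := by exact_mod_cast Nat.pos_of_ne_zero (NeZero.ne N)
  have hn' : (0 : ℝ) < n := by exact_mod_cast hn
  have hd' : (2 : ℝ) ≤ d := by exact_mod_cast hd
  have hD : Real.log 2 ≤ Real.log d := Real.log_le_log (by norm_num) hd'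
  have hD0 : 0 < Real.log d := (Real.log_pos (by norm_num)).trans_le hD
  -- Only `(N + d) / N ≥ 1` is needed here.
  have hL : μ₀ * r * β * Real.log d ≤ μ₀ * r * (N + d) * β * Real.log d / N := by
    rw [le_div_iff₀ hN]
    have : 0 ≤ μ₀ * r * β * Real.log d * d := by
      have : 0 < μ₀ * r := by linarith
      positivity
    linarith
  obtain ⟨hlpos, hle⟩ := le_of_exponent (m := (n : ℝ) / N) (by positivity) hq hβ hD hL hl
  refine le_trans ?_ (le_sum_weights_mul hlpos (Q := μ₀ * r / N) (fun i => by positivity) ?_ ?_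
    (by have : 0 < μ₀ * r := by linarith
        positivity) ha.le)
  · rw [le_div_iff₀ hlpos, c₁_eq]
    refine hle.trans (le_of_eq ?_)
    have e : μ₀ * r / N * (N * Real.exp (-((n : ℝ) / N * (1 - Real.exp (-l)))) /
        (2 * (d : ℝ) ^ (2 - 2 * β))) = μ₀ * r * Real.exp (-((n : ℝ) / N * (1 - Real.exp (-l)))) /
        (2 * (d : ℝ) ^ (2 - 2 * β)) := by
      field_simp
    have hdp : (0 : ℝ) < (d : ℝ) ^ (2 - 2 * β) := by positivity
    rw [e, Real.log_div (by have := Real.exp_pos (-((n : ℝ) / N * (1 - Real.exp (-l)))); positivity)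
      (by positivity), Real.log_mul (by linarith) (Real.exp_pos _).ne', Real.log_exp,
      Real.log_mul (by norm_num) hdp.ne', Real.log_rpow (by linarith)]
    ring
  · rw [← Finset.sum_div, ← frobenius_norm_sq, div_self (by positivity)]
  · intro i
    rw [div_le_iff₀ (by positivity)]
    exact hX i

/-- Only the zero matrix has rows of norm less than the average. -/
theorem eq_zero_of_row_le {N : ℕ} {κ : Type*} [Fintype κ] {q : ℝ} (hq : q < 1)
    {X : Matrix (Fin N) κ ℂ} (hX : ∀ i, ∑ j, ‖X i j‖ ^ 2 ≤ q / N * ‖X‖ ^ 2) : X = 0 := by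
  by_contra h0
  have hpos : 0 < ‖X‖ ^ 2 := by have := norm_pos_iff.2 h0; positivity
  have hN : (N : ℝ) ≠ 0 := by
    rintro h
    have : N = 0 := by exact_mod_cast h
    subst this
    exact h0 (Matrix.ext fun i => i.elim0)
  have h := Finset.sum_le_sum fun i (_ : i ∈ Finset.univ) => hX i
  rw [← frobenius_norm_sq, Finset.sum_const, Finset.card_univ, Fintype.card_fin, nsmul_eq_mul,
    ← mul_assoc, mul_div_cancel₀ _ hN] at h
  nlinarith

end Main

end KSpace

theorem theorem1 {Θ Φ Ψ : Type*} {p₁ p₂ p₃ N Nc l₁ l₂ : ℕ} [NeZero N]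
    (F : KSpace.Networks Θ Φ Ψ p₁ p₂ p₃ N Nc l₁ l₂)
    (n d r : ℕ) (s μ₀ β : ℝ) (hβ : 1 < β)
    -- the set of possible sequences of sampled locations: all sequences (independent uniform draws)
    -- or the sequences of distinct locations (a uniformly random 0/1 mask)
    (A : Set (Fin n → Fin N))
    (hA : A = Set.univ ∨ (A = {a | Function.Injective a} ∧ n ≤ N))
    -- ground truth, noise, and observation `y = M x* + noise`
    (x : Matrix (Fin N) (Fin Nc) ℂ)
    (noise : (Fin n → Fin N) → Matrix (Fin N) (Fin Nc) ℂ)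
    -- the optimal network and its input, for each sampling trajectory
    (θ : (Fin n → Fin N) → Θ) (φ : (Fin n → Fin N) → Φ) (ψ : (Fin n → Fin N) → Ψ)
    (ξ : (Fin n → Fin N) → EuclideanSpace ℂ (Fin p₁))
    (ζ : (Fin n → Fin N) → EuclideanSpace ℂ (Fin p₂))
    (η : (Fin n → Fin N) → EuclideanSpace ℂ (Fin p₃))
    (hopt : ∀ a ∈ A, F.IsOptimal s a (KSpace.sample a x + noise a)
      (θ a) (φ a) (ψ a) (ξ a) (ζ a) (η a))
    (hrank : ∀ a ∈ A, F.RankDeficient s d r (θ a))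
    -- the input of a best approximation of `[x*, x*]` in `G(B(s), ζ, η)`
    (ξt : (Fin n → Fin N) → EuclideanSpace ℂ (Fin p₁))
    (hξt : ∀ a ∈ A, ‖ξt a‖ ≤ s ∧ ∀ ξ', ‖ξ'‖ ≤ s →
      ‖F.gen (θ a) (φ a) (ψ a) (ξt a) (ζ a) (η a) - Matrix.fromCols x x‖ ≤
        ‖F.gen (θ a) (φ a) (ψ a) ξ' (ζ a) (η a) - Matrix.fromCols x x‖)
    (hμ : ∀ a ∈ A,
      max (KSpace.coherence (KSpace.leftSpace (F.diffHankel d (θ a) (ξ a) (ξt a))))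
        (KSpace.coherence (KSpace.rightSpace (F.diffHankel d (θ a) (ξ a) (ξt a)))) ≤ μ₀)
    (hn : 5.34 * μ₀ * r * (N + d) * β * Real.log d < n) :
    0 < KSpace.c₁ n N d r μ₀ β ∧
    1 - 2 * (d : ℝ) ^ (2 - 2 * β) ≤ (ProbabilityTheory.uniformOn A).real
      {a | ‖F.gen (θ a) (φ a) (ψ a) (ξ a) (ζ a) (η a) - Matrix.fromCols x x‖ ≤
        ‖F.gen (θ a) (φ a) (ψ a) (ξt a) (ζ a) (η a) - Matrix.fromCols x x‖ +
          (2 * ‖KSpace.sample a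
              (F.gen (θ a) (φ a) (ψ a) (ξt a) (ζ a) (η a) - Matrix.fromCols x x)‖ +
            4 * ‖noise a‖) / KSpace.c₁ n N d r μ₀ β} := by
  have hne : A.Nonempty := by
    rcases hA with rfl | ⟨rfl, hnN⟩
    · exact Set.univ_nonempty
    · exact ⟨Fin.castLE hnN, Fin.castLE_injective hnN⟩
  obtain ⟨a₀, ha₀⟩ := hne
  have hμ₀ : 0 ≤ μ₀ :=
    (KSpace.coherence_nonneg _).trans ((le_max_left _ _).trans (hμ a₀ ha₀))
  have hrd : r < d := (hrank a₀ ha₀).2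
  have hN : (0 : ℝ) < N := by exact_mod_cast Nat.pos_of_ne_zero (NeZero.ne N)
  have hc := KSpace.c₁_pos hβ hμ₀ hn
  refine ⟨hc, ?_⟩
  have hflat : ∀ a ∈ A, ∀ i, _ := fun a ha i =>
    F.row_gen_sub_le (φ a) (ψ a) (ζ a) (η a)
      ((hrank a ha).1 (ξ a) (ξt a) (hopt a ha).1.1 (hξt a ha).1) hrd
      ((le_max_left _ _).trans (hμ a ha)) i
  have hbound : ∀ a ∈ A, KSpace.c₁ n N d r μ₀ β *
        ‖F.gen (θ a) (φ a) (ψ a) (ξ a) (ζ a) (η a) - F.gen (θ a) (φ a) (ψ a) (ξt a) (ζ a) (η a)‖ ≤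
      ‖KSpace.sample a (F.gen (θ a) (φ a) (ψ a) (ξ a) (ζ a) (η a) -
        F.gen (θ a) (φ a) (ψ a) (ξt a) (ζ a) (η a))‖ →
      ‖F.gen (θ a) (φ a) (ψ a) (ξ a) (ζ a) (η a) - Matrix.fromCols x x‖ ≤
        ‖F.gen (θ a) (φ a) (ψ a) (ξt a) (ζ a) (η a) - Matrix.fromCols x x‖ +
          (2 * ‖KSpace.sample a
              (F.gen (θ a) (φ a) (ψ a) (ξt a) (ζ a) (η a) - Matrix.fromCols x x)‖ +
            4 * ‖noise a‖) / KSpace.c₁ n N d r μ₀ β := by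
    intro a ha h
    have h1 := h.trans ((hopt a ha).norm_sample_sub_le (hξt a ha).1)
    rw [mul_comm, ← le_div_iff₀ hc] at h1
    refine le_trans ?_ (add_le_add_right h1 _)
    rw [← sub_add_sub_cancel' (F.gen (θ a) (φ a) (ψ a) (ξt a) (ζ a) (η a))]
    exact norm_add_le _ _
  by_cases hq : μ₀ * r < 1
  -- Here the two outputs coincide for every outcome, so the bound holds surely.
  · have hP := ProbabilityTheory.uniformOn_eq_one_of A.toFinite ⟨a₀, ha₀⟩ fun a ha =>
      hbound a ha (by rw [KSpace.eq_zero_of_row_le hq (hflat a ha)]; simp [KSpace.sample])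
    have hd : 0 ≤ (d : ℝ) ^ (2 - 2 * β) := by positivity
    have hP' := congrArg ENNReal.toReal hP
    rw [ENNReal.toReal_one] at hP'
    exact (by linarith : _ ≤ (1 : ℝ)).trans hP'.ge
  · rw [not_lt] at hq
    have hr : 1 ≤ r := by
      by_contra h
      have : r = 0 := by omega
      subst this
      norm_num at hq
    have hd : 2 ≤ d := by omega
    have hd' : (2 : ℝ) ≤ d := by exact_mod_cast hd
    have hlog : Real.log 2 ≤ Real.log d := Real.log_le_log (by norm_num) hd'
    have hlog2 := Real.log_two_gt_d9
    -- Since `μ₀ * r ≥ 1`, `β > 1` and `log d ≥ log 2 > 0.69`, the lower bound on `n` exceeds `5.34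
    -- * 0.69 * N > N`.
    have hNn : (N : ℝ) < n := by
      refine lt_of_le_of_lt ?_ hn
      calc (N : ℝ) ≤ N * (5.34 * 0.69) := by nlinarith
        _ = 5.34 * 1 * N * 1 * 0.69 := by ring
        _ ≤ 5.34 * (μ₀ * r) * (N + d) * β * Real.log d := by
          gcongr <;> linarith
        _ = _ := by ring
    have hA' : A = Set.univ := by
      rcases hA with h | ⟨-, h⟩
      · exact h
      · exact absurd hNn (not_lt.2 (by exact_mod_cast h))
    subst hA'
    have hn0 : 0 < n := by
      have : (0 : ℝ) < n := hN.trans hNn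
      exact_mod_cast this
    refine KSpace.uniformOn_univ_of_sum_exp_lt (by positivity) (l :=
      √(16 / 3 * ((n : ℝ) / N) * (μ₀ * r * (N + d) * β * Real.log d / N)) / (n / N)) fun a ha => ?_
    exact hbound a (Set.mem_univ a)
      (KSpace.c₁_mul_norm_le_norm_sample hβ hn0 hd hq rfl ha _ (hflat a (Set.mem_univ a)))
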